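/- Let $K$ be a nonarchimedean local field with residue field of order $q_K$, fix an algebraic closure $\overline{K}$ of $K$, and let $K^{tr}\subset\overline{K}$ be the maximal tamely ramified extension of $K$, i.e. the compositum of all finite tamely ramified extensions of $K$ inside $\overline{K}$ (a finite extension $M/K$ is tamely ramified if its ramification index $e(M/K)$ is prime to $q_K$). Let $L\subset\overline{K}$ be a totally tamely ramified extension of $K$ of degree $e$, that is, a finite tamely ramified extension with $e(L/K)=[L:K]=e$, and let $F$ be the maximal subextension $K\subset F\subset L$ that is Galois over $K$. Then: (1) $\mathrm{Gal}(F/K)$ is cyclic; (2) $[F:K]=\gcd(e,\,q_K-1)$; (3) if $L'\subset\overline{K}$ is a totally tamely ramified extension of $K$ of degree $e$ that contains $F$, then $L'=g(L)$ for some $g\in\mathrm{Gal}(K^{tr}/K)$. -/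

import Mathlib

open ValuativeRel

namespace TameRamification

section Basic

variable (K : Type*) [Field K] [ValuativeRel K] [TopologicalSpace K]
  [IsNonarchimedeanLocalField K] (L : Type*) [Field L] [Algebra K L]

/-- The order `q_K` of the residue field of `K`. -/
noncomputable def residueCard : ℕ := Nat.card 𝓀[K]

/-- The ramification index `e(L/K)` of a finite extension `L/K`. The valuation ring of `L` is the
integral closure of `𝒪[K]` in `L`; as `K` is complete, exactly one prime of that ring lies over
the maximal ideal `𝓂[K]`, and `e(L/K)` is the ramification index of this prime over `𝒪[K]`. -/
noncomputable def ramificationIndex : ℕ :=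
  (𝓂[K]).ramificationIdxIn (integralClosure 𝒪[K] L)

/-- A finite extension `L/K` is tamely ramified if `e(L/K)` is prime to the residue
characteristic (residue field extensions are automatically separable, as `𝓀[K]` is finite). -/
structure IsTamelyRamified : Prop where
  finiteDimensional : FiniteDimensional K L
  coprime : (ramificationIndex K L).Coprime (residueCard K)

/-- A tamely ramified finite extension `L/K` is totally tamely ramified if `e(L/K) = [L : K]`. -/
structure IsTotallyTamelyRamified : Prop extends IsTamelyRamified K L where
  ramificationIndex_eq : ramificationIndex K L = Module.finrank K L

end Basic

section MaxTame

variable (K : Type*) [Field K] [ValuativeRel K] [TopologicalSpace K]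
  [IsNonarchimedeanLocalField K] (Ω : Type*) [Field Ω] [Algebra K Ω]

/-- The maximal tamely ramified extension `K^tr` of `K` inside `Ω`: the compositum of all finite
tamely ramified extensions of `K` inside `Ω`. -/
noncomputable def maxTame : IntermediateField K Ω :=
  sSup {L : IntermediateField K Ω | IsTamelyRamified K L}

variable {K Ω} in
theorem IsTotallyTamelyRamified.le_maxTame {L : IntermediateField K Ω}
    (hL : IsTotallyTamelyRamified K L) : L ≤ maxTame K Ω :=
  le_sSup hL.toIsTamelyRamified

end MaxTame

section MaxGalois

variable {K Ω : Type*} [Field K] [Field Ω] [Algebra K Ω]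

/-- The maximal Galois subextension of `L/K`: the compositum of all intermediate fields of `L/K`
that are Galois over `K`. -/
noncomputable def maxGalois (L : IntermediateField K Ω) : IntermediateField K Ω :=
  sSup {M : IntermediateField K Ω | M ≤ L ∧ IsGalois K M}

/-- `maxGalois L` is Galois over `K`, and it is the largest such field inside `L`. -/
theorem isGreatest_maxGalois (L : IntermediateField K Ω) :
    IsGreatest {M : IntermediateField K Ω | M ≤ L ∧ IsGalois K M} (maxGalois L) := by
  refine ⟨⟨sSup_le fun M hM => hM.1, ?_⟩, fun M hM => le_sSup hM⟩
  unfold maxGalois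
  rw [sSup_eq_iSup']
  have h : ∀ M : {M : IntermediateField K Ω | M ≤ L ∧ IsGalois K M}, IsGalois K M.1 :=
    fun M => M.2.2
  have hsep : ∀ M : {M : IntermediateField K Ω | M ≤ L ∧ IsGalois K M},
      Algebra.IsSeparable K M.1 := fun M => (h M).to_isSeparable
  have hs : Algebra.IsSeparable K
      (⨆ M : {M : IntermediateField K Ω | M ≤ L ∧ IsGalois K M}, M.1 : IntermediateField K Ω) :=
    inferInstance
  have hn := IntermediateField.normal_iSup K Ω
    (fun M : {M : IntermediateField K Ω | M ≤ L ∧ IsGalois K M} => M.1)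
    (h := fun M => (h M).to_normal)
  exact ⟨⟩

end MaxGalois

end TameRamification

/-! Write `q` for the order of the residue field and `d = gcd(e, q - 1)`. The valuation ring of `L`
is a complete discrete valuation ring with the same residue field as that of `K`. A power of a
uniformizer of `L` is a uniformizer of `K` up to a unit; Hensel's lemma absorbs the one-unit part,
because `e` is prime to `q`. Hence `L = K(α)` with `α ^ e = π` a uniformizer of `K`
(`exists_pow_eq_irreducible_of_ramificationIdx_eq`).

A subfield `M` of `L` of degree `f` contains `α ^ (e / f)`, by taking the norm of `α`
(`pow_finrank_mem_of_le`). If `M` is normal, it contains all conjugates of that element, hence the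
`f`-th roots of unity, and these exist in `L` only if `f ∣ q - 1`
(`finrank_dvd_card_sub_one_of_normal`). Conversely `K` contains the `(q - 1)`-th roots of unity, so
`K(α ^ (e / d))` is a cyclic Kummer extension of degree `d`. It is therefore the maximal Galois
subextension.

For conjugacy, write `L' = K(α')` with `α' ^ e = π u`, `u` a unit of the base. If `α ^ (e / d)` lies
in `L'`, then `u` is a `d`-th power in `L'`. Since the residue field does not grow, `u = c ^ e` with
`c` in `K` (`IsLocalRing.exists_eq_pow_of_pow_gcd_eq`). So `α' / c` is a root of `X ^ e - π`,
conjugate to `α`. -/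

/-! ### Adic completeness of finite free algebras -/

theorem Ideal.mem_map_pow_iff_repr_mem {R B ι : Type*} [CommRing R] [CommRing B] [Algebra R B]
    [Finite ι] (b : Module.Basis ι R B) (I : Ideal R) (n : ℕ) (x : B) :
    x ∈ I.map (algebraMap R B) ^ n ↔ ∀ i, b.repr x i ∈ I ^ n := by
  have := Fintype.ofFinite ι
  rw [← Ideal.map_pow]
  constructor
  · intro hx i
    refine Submodule.span_induction ?_ ?_ ?_ ?_ hx (p := fun x _ => ∀ i, b.repr x i ∈ I ^ n) i
    · rintro _ ⟨r, hr, rfl⟩ i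
      rw [Algebra.algebraMap_eq_smul_one, map_smul]
      exact Ideal.mul_mem_right _ _ hr
    · simp
    · intro x y _ _ hx hy i
      simpa using add_mem (hx i) (hy i)
    · intro a x _ hx i
      rw [← b.sum_repr x, smul_eq_mul, Finset.mul_sum, map_sum, Finset.sum_apply']
      refine _root_.sum_mem fun j _ => ?_
      rw [mul_smul_comm, map_smul]
      exact Ideal.mul_mem_right _ _ (hx j)
  · intro h
    rw [← b.sum_repr x]
    refine _root_.sum_mem fun i _ => ?_
    rw [Algebra.smul_def]
    exact Ideal.mul_mem_right _ _ (Ideal.mem_map_of_mem _ (h i))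

/-- A finite free algebra over an adically complete ring is adically complete. -/
theorem IsAdicComplete.map_algebraMap {R : Type*} (B : Type*) [CommRing R] [CommRing B]
    [Algebra R B] [Module.Free R B] [Module.Finite R B] (I : Ideal R) [IsAdicComplete I R] :
    IsAdicComplete (I.map (algebraMap R B)) B := by
  let b := Module.Free.chooseBasis R B
  have key := Ideal.mem_map_pow_iff_repr_mem b I
  refine { haus' := ?_, prec' := ?_ }
  · intro x hx
    refine b.repr.map_eq_zero_iff.mp (Finsupp.ext fun i => ?_)
    refine IsHausdorff.haus' (I := I) _ fun n => ?_
    have := hx n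
    rw [SModEq.zero, smul_eq_mul, Ideal.mul_top] at this ⊢
    exact (key n x).mp this i
  · intro f hf
    have hf' : ∀ i, ∀ {m n}, m ≤ n →
        b.repr (f m) i ≡ b.repr (f n) i [SMOD (I ^ m • ⊤ : Ideal R)] := by
      intro i m n hmn
      have := hf hmn
      rw [SModEq.sub_mem, smul_eq_mul, Ideal.mul_top] at this ⊢
      simpa using (key m _).mp this i
    choose g hg using fun i => IsPrecomplete.prec' _ (hf' i)
    refine ⟨∑ i, g i • b i, fun n => ?_⟩
    rw [SModEq.sub_mem, smul_eq_mul, Ideal.mul_top]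
    refine (key n _).mpr fun i => ?_
    have := hg i n
    rw [SModEq.sub_mem, smul_eq_mul, Ideal.mul_top] at this
    rw [map_sub, Finsupp.sub_apply, b.repr_sum_self]
    exact this

/-- The two ideals define the same topology: the subsequence of indices `N * n` turns `J`-adic
estimates into `I`-adic ones. It passes from the extension of the maximal ideal of the base to the
maximal ideal above it. -/
theorem IsAdicComplete.of_pow_le {R : Type*} [CommRing R] {I J : Ideal R} [IsAdicComplete I R]
    (hIJ : I ≤ J) {N : ℕ} (hN : J ^ N ≤ I) : IsAdicComplete J R := by
  refine { haus' := ?_, prec' := ?_ }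
  · intro x hx
    refine IsHausdorff.haus' (I := I) _ fun n => ?_
    have := hx (N * n)
    rw [SModEq.zero, smul_eq_mul, Ideal.mul_top] at this ⊢
    rw [pow_mul] at this
    exact Ideal.pow_right_mono hN n this
  · intro f hf
    have hf' : ∀ {m n}, m ≤ n → f (N * m) ≡ f (N * n) [SMOD (I ^ m • ⊤ : Ideal R)] := by
      intro m n hmn
      have := hf (Nat.mul_le_mul_left N hmn)
      rw [SModEq.sub_mem, smul_eq_mul, Ideal.mul_top] at this ⊢
      rw [pow_mul] at this
      exact Ideal.pow_right_mono hN m this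
    obtain ⟨l, hl⟩ := IsPrecomplete.prec' _ hf'
    refine ⟨l, fun n => ?_⟩
    -- For `N = 0` the bound `n ≤ N * n` fails, but then `I` and `J` are the unit ideal.
    obtain rfl | hN0 := N.eq_zero_or_pos
    · have h1 : I = ⊤ := by simpa using hN
      subst h1
      rw [SModEq.sub_mem, top_le_iff.mp hIJ, Ideal.top_pow]
      simp
    have h1 := hf (Nat.le_mul_of_pos_left n hN0)
    have h2 := hl n
    rw [SModEq.sub_mem, smul_eq_mul, Ideal.mul_top] at h1 h2 ⊢
    rw [← sub_add_sub_cancel _ (f (N * n))]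
    exact add_mem h1 (Ideal.pow_right_mono hIJ n h2)

/-! ### Uniqueness of the prime above the maximal ideal -/

/-- Every idempotent modulo a Henselian ideal of a domain is trivial. -/
theorem Ideal.mem_or_sub_one_mem_of_sq_sub_mem {C : Type*} [CommRing C] [IsDomain C]
    (I : Ideal C) [HenselianRing C I] {a : C} (ha : a ^ 2 - a ∈ I) : a ∈ I ∨ a - 1 ∈ I := by
  have hu : IsUnit (Ideal.Quotient.mk I ((Polynomial.X ^ 2 - Polynomial.X :
      Polynomial C).derivative.eval a)) := by
    -- The derivative `2a - 1` is its own inverse modulo `I`, since `(2a - 1)² - 1 = 4(a² - a)`.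
    refine IsUnit.of_mul_eq_one (Ideal.Quotient.mk I (2 * a - 1)) ?_
    rw [← map_mul, ← map_one (Ideal.Quotient.mk I), Ideal.Quotient.eq]
    simp only [Polynomial.derivative_sub, Polynomial.derivative_X_pow, Polynomial.derivative_X,
      Polynomial.eval_sub, Polynomial.eval_mul, Polynomial.eval_C, Polynomial.eval_pow,
      Polynomial.eval_X, Polynomial.eval_one]
    convert I.mul_mem_left 4 ha using 1
    push_cast
    ring
  obtain ⟨r, hr, hra⟩ := HenselianRing.is_henselian (I := I)
    (Polynomial.X ^ 2 - Polynomial.X : Polynomial C) (by monicity!) a (by simpa using ha) hu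
  have hr' : r * (r - 1) = 0 := by
    simp only [Polynomial.IsRoot.def, Polynomial.eval_sub, Polynomial.eval_pow,
      Polynomial.eval_X] at hr
    linear_combination hr
  rcases mul_eq_zero.mp hr' with h | h
  · left
    subst h
    simpa using hra
  · right
    rw [sub_eq_zero.mp h] at hra
    simpa using I.neg_mem hra

theorem exists_pow_isIdempotentElem {M : Type*} [Monoid M] [Finite M] (a : M) :
    ∃ n, 0 < n ∧ a ^ (2 * n) = a ^ n := by
  obtain ⟨i, j, hij, h⟩ := Finite.exists_ne_map_eq_of_infinite (fun n : ℕ => a ^ n)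
  wlog hlt : i < j generalizing i j
  · exact this j i hij.symm h.symm (lt_of_le_of_ne (not_lt.mp hlt) hij.symm)
  obtain ⟨d, hd, rfl⟩ : ∃ d, 0 < d ∧ j = i + d := ⟨j - i, by omega, by omega⟩
  have h1 : ∀ k, a ^ (i + d * k) = a ^ i := by
    intro k
    induction k with
    | zero => simp
    | succ k ih =>
      rw [Nat.mul_succ, ← add_assoc, add_right_comm, pow_add, ← show a ^ i = a ^ (i + d) from h,
        ← pow_add, ih]
  -- Any positive multiple of the period `d` that is at least the preperiod `i` would do.
  refine ⟨d * (i + 1), by positivity, ?_⟩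
  have h2 : d * (i + 1) = i + (d * (i + 1) - i) := by
    have : i + 1 ≤ d * (i + 1) := Nat.le_mul_of_pos_left _ hd
    omega
  calc a ^ (2 * (d * (i + 1))) = a ^ (i + d * (i + 1) + (d * (i + 1) - i)) := by
        congr 1; omega
    _ = a ^ (d * (i + 1)) := by rw [pow_add, h1, ← pow_add, ← h2]

open IsLocalRing in
/-- An integral extension domain of a complete discrete valuation ring with finite residue field
has only one prime over the maximal ideal. -/
theorem Ideal.le_of_liesOver_maximalIdeal {R B : Type*} [CommRing R] [IsDomain R]
    [IsDiscreteValuationRing R] [IsAdicComplete (maximalIdeal R) R]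
    [Finite (IsLocalRing.ResidueField R)]
    [CommRing B] [IsDomain B] [Algebra R B] [FaithfulSMul R B] [Algebra.IsIntegral R B]
    {P Q : Ideal B} [P.IsPrime] [Q.IsPrime] [hP : P.LiesOver (maximalIdeal R)]
    [hQ : Q.LiesOver (maximalIdeal R)] : P ≤ Q := by
  intro b hb
  -- `B` need not be finite over `R`, but `R[b]` is finite and free, hence complete, with finite
  -- reduction. Some power of `b` is idempotent in that reduction, so it is `0` or `1` there; the
  -- value `1` is excluded by `b ∈ P`, and `0` forces `b ∈ Q`.
  let C := Algebra.adjoin R {b}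
  have : Module.Finite R C :=
    ⟨(Submodule.fg_top _).mpr (Algebra.IsIntegral.isIntegral b).fg_adjoin_singleton⟩
  have : Module.IsTorsionFree R B := inferInstance
  have : Module.IsTorsionFree R C := inferInstance
  have : Module.Free R C := inferInstance
  let I := (maximalIdeal R).map (algebraMap R C)
  have : IsAdicComplete I C := IsAdicComplete.map_algebraMap C _
  have : Finite (R ⧸ maximalIdeal R) := inferInstanceAs (Finite (IsLocalRing.ResidueField R))
  have : Module.Finite (R ⧸ maximalIdeal R) (C ⧸ I) := inferInstance
  have : Finite (C ⧸ I) := Module.finite_of_finite (R ⧸ maximalIdeal R)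
  have hI : ∀ S : Ideal B, S.LiesOver (maximalIdeal R) → ∀ c ∈ I, (c : B) ∈ S := by
    intro S hS c hc
    have : I ≤ S.comap (algebraMap C B) := by
      rw [Ideal.map_le_iff_le_comap, Ideal.comap_comap, ← IsScalarTower.algebraMap_eq]
      exact hS.over.le
    exact this hc
  let c : C := ⟨b, Algebra.self_mem_adjoin_singleton R b⟩
  obtain ⟨n, hn, h⟩ := exists_pow_isIdempotentElem (Ideal.Quotient.mk I c)
  have h' : (c ^ n) ^ 2 - c ^ n ∈ I := by
    rw [← pow_mul, mul_comm n, ← Ideal.Quotient.eq]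
    simpa using h
  rcases I.mem_or_sub_one_mem_of_sq_sub_mem h' with h1 | h1
  · exact ‹Q.IsPrime›.mem_of_pow_mem n (by simpa [c] using hI Q hQ _ h1)
  · refine absurd ?_ ‹P.IsPrime›.one_notMem
    have h2 : b ^ n - 1 ∈ P := by simpa [c] using hI P hP _ h1
    simpa using P.sub_mem (Ideal.pow_mem_of_mem P hb n hn) h2

/-! ### Hensel's lemma and Eisenstein polynomials -/

section LocalRing

open IsLocalRing

/-- One-units of a Henselian ring are `n`-th powers when `n` is a unit. -/
theorem HenselianRing.exists_pow_eq {C : Type*} [CommRing C] (I : Ideal C) [HenselianRing C I]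
    {n : ℕ} (hn0 : n ≠ 0) (hn : IsUnit (n : C)) {x : C} (hx : x - 1 ∈ I) :
    ∃ w : C, w ^ n = x ∧ w - 1 ∈ I := by
  obtain ⟨w, hw, hw1⟩ := HenselianRing.is_henselian (I := I)
    (Polynomial.X ^ n - Polynomial.C x) (Polynomial.monic_X_pow_sub_C x hn0) 1
    (by simpa using I.neg_mem hx)
    (by simpa [Polynomial.derivative_X_pow] using hn.map (Ideal.Quotient.mk I))
  exact ⟨w, by simpa [sub_eq_zero] using hw, hw1⟩

theorem IsLocalRing.isUnit_natCast_of_coprime {R : Type*} [CommRing R] [IsLocalRing R]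
    [Finite (IsLocalRing.ResidueField R)]
    {n : ℕ} (h : n.Coprime (Nat.card (ResidueField R))) : IsUnit (n : R) := by
  rw [← residue_ne_zero_iff_isUnit, map_natCast]
  intro h0
  have h1 : ((n.gcd (Nat.card (ResidueField R)) : ℤ) : ResidueField R) = 0 := by
    rw [Nat.gcd_eq_gcd_ab]
    push_cast
    have := Fintype.ofFinite (ResidueField R)
    rw [h0, Nat.card_eq_fintype_card, FiniteField.cast_card_eq_zero]
    simp
  rw [h] at h1
  simp at h1

/-- Eisenstein's criterion at `(π)`, followed by Gauss's lemma. -/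
theorem Polynomial.irreducible_X_pow_sub_C_of_irreducible {R : Type*} (K : Type*) [CommRing R]
    [IsDomain R] [IsDiscreteValuationRing R] [Field K] [Algebra R K] [IsFractionRing R K] {n : ℕ}
    (hn : n ≠ 0) {π : R} (hπ : Irreducible π) :
    Irreducible (X ^ n - C (algebraMap R K π) : Polynomial K) := by
  have hm : (X ^ n - C π : Polynomial R).Monic := monic_X_pow_sub_C π hn
  have hp : (Ideal.span {π}).IsPrime := (Ideal.span_singleton_prime hπ.ne_zero).mpr hπ.prime
  have hE : (X ^ n - C π : Polynomial R).IsEisensteinAt (Ideal.span {π}) := by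
    refine hm.isEisensteinAt_of_mem_of_notMem hp.ne_top ?_ ?_
    · intro i hi
      rw [natDegree_X_pow_sub_C] at hi
      rw [coeff_sub, coeff_X_pow, if_neg hi.ne, coeff_C]
      split_ifs
      · simp
      · simp
    · rw [coeff_sub, coeff_X_pow, if_neg hn.symm, coeff_C_zero, zero_sub, Ideal.neg_mem_iff,
        Ideal.span_singleton_pow, Ideal.mem_span_singleton]
      intro h
      rw [sq] at h
      exact hπ.not_isUnit (isUnit_of_dvd_one
        ((mul_dvd_mul_iff_left hπ.ne_zero).mp (by simpa using h)))
  have := hE.irreducible hp hm.isPrimitive (by rw [natDegree_X_pow_sub_C]; omega)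
  rw [hm.irreducible_iff_irreducible_map_fraction_map (K := K)] at this
  simpa using this

/-! ### Ramification and uniformizers -/

section

variable {R B : Type*} [CommRing R] [IsDomain R] [IsDiscreteValuationRing R]
  [IsAdicComplete (maximalIdeal R) R]
    [Finite (IsLocalRing.ResidueField R)]
  [CommRing B] [IsDomain B] [Algebra R B] [FaithfulSMul R B] [Algebra.IsIntegral R B]

theorem Ideal.liesOver_maximalIdeal_of_isMaximal {R B : Type*} [CommRing R] [IsLocalRing R]
    [CommRing B] [Algebra R B] [Algebra.IsIntegral R B] (P : Ideal B) [P.IsMaximal] :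
    P.LiesOver (maximalIdeal R) :=
  ⟨(IsLocalRing.eq_maximalIdeal (Ideal.isMaximal_comap_of_isIntegral_of_isMaximal P)).symm⟩

theorem Algebra.IsIntegral.isLocalRing_of_isAdicComplete (R B : Type*) [CommRing R] [IsDomain R]
    [IsDiscreteValuationRing R] [IsAdicComplete (maximalIdeal R) R]
    [Finite (IsLocalRing.ResidueField R)] [CommRing B] [IsDomain B] [Algebra R B]
    [FaithfulSMul R B] [Algebra.IsIntegral R B] : IsLocalRing B := by
  obtain ⟨P, hP⟩ := Ideal.exists_maximal B
  have := P.liesOver_maximalIdeal_of_isMaximal (R := R)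
  refine IsLocalRing.of_unique_max_ideal ⟨P, hP, fun Q hQ => ?_⟩
  have : Q.IsMaximal := hQ
  have := Q.liesOver_maximalIdeal_of_isMaximal (R := R)
  exact le_antisymm (Ideal.le_of_liesOver_maximalIdeal (R := R))
    (Ideal.le_of_liesOver_maximalIdeal (R := R))

theorem Ideal.eq_maximalIdeal_of_liesOver [IsLocalRing B] {P : Ideal B} [P.IsPrime]
    [P.LiesOver (maximalIdeal R)] : P = maximalIdeal B :=
  have := (maximalIdeal B).liesOver_maximalIdeal_of_isMaximal (R := R)
  le_antisymm (Ideal.le_of_liesOver_maximalIdeal (R := R))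
    (Ideal.le_of_liesOver_maximalIdeal (R := R))

/-- The ramification index of the maximal ideal is independent of the choice of prime. -/
theorem Ideal.ramificationIdxIn_maximalIdeal [IsLocalRing B] :
    (maximalIdeal R).ramificationIdxIn B = (maximalIdeal B).ramificationIdx R := by
  have h : ∃ P : Ideal B, P.IsPrime ∧ P.LiesOver (maximalIdeal R) :=
    ⟨maximalIdeal B, inferInstance, Ideal.liesOver_maximalIdeal_of_isMaximal _⟩
  rw [Ideal.ramificationIdxIn, dif_pos h]
  have := h.choose_spec.1
  have := h.choose_spec.2
  rw [Ideal.eq_maximalIdeal_of_liesOver (R := R) (P := h.choose)]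

/-- The index is a length of the localization modulo the extended ideal, and the isomorphism passes
to these quotients. -/
theorem Ideal.ramificationIdx_map_algEquiv {R S T : Type*} [CommRing R] [CommRing S] [CommRing T]
    [Algebra R S] [Algebra R T] (q : Ideal S) [q.IsPrime] (f : S ≃ₐ[R] T) (q' : Ideal T)
    [q'.IsPrime] (hq : q = q'.comap f) : q'.ramificationIdx R = q.ramificationIdx R := by
  let p := q.under R
  have : q'.LiesOver p := ⟨by
    simp only [p, hq, Ideal.under_def]
    ext x
    simp⟩
  let Sq := Localization.AtPrime q
  let Sq' := Localization.AtPrime q'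
  let g : Sq ≃ₐ[R] Sq' := Localization.localAlgEquiv q q' f hq
  let : Algebra Sq Sq' := g.toRingHom.toAlgebra
  have : IsScalarTower R Sq Sq' := IsScalarTower.of_algHom g.toAlgHom
  let e : (Sq ⧸ p.map (algebraMap R Sq)) ≃ₐ[Sq] Sq' ⧸ p.map (algebraMap R Sq') :=
    Ideal.quotientEquivAlg _ _ (AlgEquiv.ofBijective (Algebra.ofId Sq Sq') g.bijective)
      (by rw [IsScalarTower.algebraMap_eq R Sq Sq', ← Ideal.map_map]; rfl)
  rw [ramificationIdx_eq p q, ramificationIdx_eq p q',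
    e.toLinearEquiv.length_eq, Module.length_eq_of_surjective g.surjective]

theorem Ideal.ramificationIdxIn_congr {B' : Type*} [CommRing B'] [IsDomain B'] [Algebra R B']
    [FaithfulSMul R B'] [Algebra.IsIntegral R B'] (f : B ≃ₐ[R] B') :
    (maximalIdeal R).ramificationIdxIn B = (maximalIdeal R).ramificationIdxIn B' := by
  have := Algebra.IsIntegral.isLocalRing_of_isAdicComplete R B
  have := Algebra.IsIntegral.isLocalRing_of_isAdicComplete R B'
  rw [ramificationIdxIn_maximalIdeal, ramificationIdxIn_maximalIdeal]
  refine (ramificationIdx_map_algEquiv _ f _ ?_).symm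
  ext x
  simp [mem_maximalIdeal, mem_nonunits_iff]

theorem IsDedekindDomain.isDiscreteValuationRing_of_isIntegral (R : Type*) {B : Type*}
    [CommRing R] [IsDomain R] [IsDiscreteValuationRing R] [CommRing B] [Algebra R B]
    [FaithfulSMul R B] [Algebra.IsIntegral R B] [IsDedekindDomain B] [IsLocalRing B] :
    IsDiscreteValuationRing B := by
  refine ((IsDiscreteValuationRing.TFAE B fun h => ?_).out 0 2).mpr ‹_›
  have := (maximalIdeal B).liesOver_maximalIdeal_of_isMaximal (R := R)
  refine IsDiscreteValuationRing.not_a_field R (le_bot_iff.mp fun x hx => ?_)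
  rw [(maximalIdeal B).over_def (maximalIdeal R), isField_iff_maximalIdeal_eq.mp h] at hx
  exact (map_eq_zero_iff _ (FaithfulSMul.algebraMap_injective R B)).mp hx

theorem Ideal.map_maximalIdeal_eq_pow {R B : Type*} [CommRing R] [IsDomain R]
    [IsDiscreteValuationRing R] [CommRing B] [IsDomain B] [Algebra R B] [FaithfulSMul R B]
    [Algebra.IsIntegral R B] [IsDiscreteValuationRing B] :
    (maximalIdeal R).map (algebraMap R B) =
      maximalIdeal B ^ (maximalIdeal B).ramificationIdx R := by
  have := (maximalIdeal B).liesOver_maximalIdeal_of_isMaximal (R := R)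
  have hinj : Function.Injective (algebraMap R B) := FaithfulSMul.algebraMap_injective R B
  have h0 : (maximalIdeal R).map (algebraMap R B) ≠ ⊥ := by
    rw [Ne, Ideal.map_eq_bot_iff_of_injective hinj]
    exact IsDiscreteValuationRing.not_a_field R
  obtain ⟨ϖ, hϖ⟩ := IsDiscreteValuationRing.exists_irreducible B
  obtain ⟨k, hk⟩ := IsDiscreteValuationRing.ideal_eq_span_pow_irreducible h0 hϖ
  rw [Ideal.IsDedekindDomain.ramificationIdx_eq_multiplicity (maximalIdeal R) _ h0, hk,
    ← Ideal.span_singleton_pow, ← hϖ.maximalIdeal_eq, multiplicity_pow_self]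
  · exact IsDiscreteValuationRing.not_a_field B
  · rw [Ideal.isUnit_iff]
    exact (maximalIdeal.isMaximal B).ne_top

/-- The identity `∑ e f = n` has a single term, so total ramification forces inertia degree `1`. -/
theorem Ideal.algebraMap_quotient_surjective_of_ramificationIdx_eq [IsLocalRing B]
    [Module.Finite R B]
    (h : (maximalIdeal B).ramificationIdx R = Module.finrank R B) (b : B) :
    ∃ r : R, b - algebraMap R B r ∈ maximalIdeal B := by
  have := (maximalIdeal B).liesOver_maximalIdeal_of_isMaximal (R := R)
  let : Unique ((maximalIdeal R).primesOver B) :=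
    { default := ⟨maximalIdeal B, inferInstance, ‹_›⟩
      uniq := fun P => by
        have := P.2.1
        have := P.2.2
        exact Subtype.ext (Ideal.eq_maximalIdeal_of_liesOver (R := R)) }
  have hsum := Ideal.sum_ramification_inertia_eq_finrank (maximalIdeal R) B
  rw [Fintype.sum_unique] at hsum
  change (maximalIdeal B).ramificationIdx R * (maximalIdeal B).inertiaDeg R = _ at hsum
  have hf : (maximalIdeal B).inertiaDeg R = 1 := by
    rw [← h] at hsum
    exact Nat.eq_of_mul_eq_mul_left ((maximalIdeal B).ramificationIdx_pos R) (by rw [hsum, mul_one])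
  rw [Ideal.inertiaDeg_eq_of_isMaximal (maximalIdeal R)] at hf
  let : Field (R ⧸ maximalIdeal R) := Ideal.Quotient.field _
  let : Field (B ⧸ maximalIdeal B) := Ideal.Quotient.field _
  obtain ⟨x, hx⟩ := (Algebra.finrank_eq_one_iff_bijective_algebraMap.mp hf).2
    (Ideal.Quotient.mk (maximalIdeal B) b)
  obtain ⟨r, rfl⟩ := Ideal.Quotient.mk_surjective x
  refine ⟨r, Ideal.Quotient.eq.mp ?_⟩
  rw [← hx]
  rfl

/-- A totally tamely ramified extension of complete discrete valuation rings contains a root of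
`X ^ e - π` for some uniformizer `π` of the base. -/
theorem exists_pow_eq_irreducible_of_ramificationIdx_eq [IsDiscreteValuationRing B]
    [Module.Finite R B]
    (h : (maximalIdeal B).ramificationIdx R = Module.finrank R B)
    (hc : (Module.finrank R B).Coprime (Nat.card (ResidueField R))) :
    ∃ (π : R) (α : B), Irreducible π ∧ α ^ Module.finrank R B = algebraMap R B π := by
  have h0 : Module.finrank R B ≠ 0 := h ▸ ((maximalIdeal B).ramificationIdx_pos R).ne'
  have hpow := Ideal.map_maximalIdeal_eq_pow (R := R) (B := B)
  rw [h] at hpow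
  have : Module.IsTorsionFree R B := inferInstance
  have : Module.Free R B := inferInstance
  have : IsAdicComplete ((maximalIdeal R).map (algebraMap R B)) B :=
    IsAdicComplete.map_algebraMap B _
  have : IsAdicComplete (maximalIdeal B) B :=
    IsAdicComplete.of_pow_le (hpow.trans_le (Ideal.pow_le_self h0)) hpow.ge
  obtain ⟨π₀, hπ₀⟩ := IsDiscreteValuationRing.exists_irreducible R
  obtain ⟨ϖ, hϖ⟩ := IsDiscreteValuationRing.exists_irreducible B
  rw [hπ₀.maximalIdeal_eq, hϖ.maximalIdeal_eq, Ideal.map_span, Set.image_singleton,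
    Ideal.span_singleton_pow, Ideal.span_singleton_eq_span_singleton] at hpow
  obtain ⟨u, hu⟩ := hpow
  -- Here `π₀ u = ϖ ^ e`. With `r` in `R` congruent to `u`, the one-unit `r u⁻¹` is some `w ^ e`,
  -- and then `(ϖ w) ^ e = π₀ r`.
  obtain ⟨r, hr⟩ := Ideal.algebraMap_quotient_surjective_of_ramificationIdx_eq h (u : B)
  have hrB : IsUnit (algebraMap R B r) := by
    by_contra hn
    exact (mem_maximalIdeal _).mp (by simpa using add_mem hr ((mem_maximalIdeal _).mpr hn)) u.isUnit
  have hrR : IsUnit r := by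
    have := (maximalIdeal B).liesOver_maximalIdeal_of_isMaximal (R := R)
    rw [← notMem_maximalIdeal, (maximalIdeal B).over_def (maximalIdeal R), Ideal.mem_comap,
      notMem_maximalIdeal]
    exact hrB
  obtain ⟨w, hw, -⟩ := HenselianRing.exists_pow_eq (maximalIdeal B)
    (x := algebraMap R B r * ↑u⁻¹) h0
    (by simpa using (isUnit_natCast_of_coprime hc).map (algebraMap R B)) (by
      have : algebraMap R B r * ↑u⁻¹ - 1 = -((u - algebraMap R B r) * ↑u⁻¹) := by
        rw [sub_mul, u.mul_inv]
        ring
      rw [this]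
      exact neg_mem (Ideal.mul_mem_right _ _ hr))
  refine ⟨π₀ * r, ϖ * w, (irreducible_mul_isUnit hrR).mpr hπ₀, ?_⟩
  rw [mul_pow, hw, ← hu, map_mul]
  linear_combination (algebraMap R B π₀ * algebraMap R B r) * u.mul_inv

end

/-! ### Roots of unity and powers of units -/

section

variable {R B : Type*} [CommRing R] [IsLocalRing R] [Finite (IsLocalRing.ResidueField R)]
  [CommRing B] [IsDomain B] [IsLocalRing B] [Algebra R B] [Algebra.IsIntegral R B]

theorem IsLocalRing.pow_card_sub_one_sub_one_mem {r : R} (hr : IsUnit r) :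
    r ^ (Nat.card (ResidueField R) - 1) - 1 ∈ maximalIdeal R := by
  have := Fintype.ofFinite (ResidueField R)
  rw [← residue_eq_zero_iff, map_sub, map_pow, map_one, Nat.card_eq_fintype_card,
    FiniteField.pow_card_sub_one_eq_one _ ((residue_ne_zero_iff_isUnit r).mpr hr), sub_self]

theorem IsLocalRing.algebraMap_mem_maximalIdeal_iff {R B : Type*} [CommRing R] [IsLocalRing R]
    [CommRing B] [IsLocalRing B] [Algebra R B] [Algebra.IsIntegral R B] {r : R} :
    algebraMap R B r ∈ maximalIdeal B ↔ r ∈ maximalIdeal R := by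
  have := (maximalIdeal B).liesOver_maximalIdeal_of_isMaximal (R := R)
  rw [(maximalIdeal B).over_def (maximalIdeal R), Ideal.mem_comap]

theorem IsLocalRing.isUnit_of_sub_algebraMap_mem {R B : Type*} [CommRing R] [IsLocalRing R]
    [CommRing B] [IsLocalRing B] [Algebra R B] [Algebra.IsIntegral R B] {b : B} (hb : IsUnit b) {r : R}
    (hr : b - algebraMap R B r ∈ maximalIdeal B) : IsUnit r := by
  rw [← notMem_maximalIdeal, ← algebraMap_mem_maximalIdeal_iff (B := B)]
  intro h
  exact (mem_maximalIdeal _).mp (by simpa using add_mem hr h) hb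

/-- If `B` has the same residue field as `R`, then the order of a root of unity of `B` of order
prime to the residue characteristic divides `q - 1`. -/
theorem IsLocalRing.pow_card_sub_one_eq_one_of_pow_eq_one
    (hres : ∀ b : B, ∃ r : R, b - algebraMap R B r ∈ maximalIdeal B) {n : ℕ} (hn0 : n ≠ 0)
    (hn : n.Coprime (Nat.card (ResidueField R))) {z : B} (hz : z ^ n = 1) :
    z ^ (Nat.card (ResidueField R) - 1) = 1 := by
  obtain ⟨r, hr⟩ := hres z
  have hru := isUnit_of_sub_algebraMap_mem (IsUnit.of_pow_eq_one hz hn0) hr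
  set q := Nat.card (ResidueField R)
  have h1 : z ^ (q - 1) - 1 ∈ maximalIdeal B := by
    have h2 : algebraMap R B r ^ (q - 1) - 1 ∈ maximalIdeal B := by
      have := (algebraMap_mem_maximalIdeal_iff (B := B)).mpr (pow_card_sub_one_sub_one_mem hru)
      rw [map_sub, map_pow, map_one] at this
      exact this
    have h3 := Ideal.mem_of_dvd _ (sub_dvd_pow_sub_pow z (algebraMap R B r) (q - 1)) hr
    simpa only [sub_add_sub_cancel] using add_mem h3 h2
  set w := z ^ (q - 1)
  have hw : w ^ n = 1 := by rw [← pow_mul, mul_comm, pow_mul, hz, one_pow]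
  -- As `w` is a one-unit, the geometric sum is congruent to the unit `n`, so it is nonzero and `w =
  -- 1`.
  have hmul : (∑ i ∈ Finset.range n, w ^ i) * (w - 1) = 0 := by rw [geom_sum_mul, hw, sub_self]
  refine sub_eq_zero.mp ((mul_eq_zero.mp hmul).resolve_left fun h0 => ?_)
  have h4 : (∑ i ∈ Finset.range n, w ^ i) - n ∈ maximalIdeal B := by
    have : (∑ i ∈ Finset.range n, w ^ i) - n = ∑ i ∈ Finset.range n, (w ^ i - 1) := by simp
    rw [this]
    exact sum_mem fun i _ => Ideal.mem_of_dvd _ (by simpa using sub_dvd_pow_sub_pow w 1 i) h1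
  rw [h0, zero_sub, neg_mem_iff] at h4
  exact (mem_maximalIdeal _).mp h4
    (by simpa using (isUnit_natCast_of_coprime hn).map (algebraMap R B))

/-- If `B` has the same residue field as the Henselian ring `R`, then a unit of `R` which is
a `gcd(e, q - 1)`-th power in `B` is an `e`-th power in `R`. -/
theorem IsLocalRing.exists_eq_pow_of_pow_gcd_eq {R B : Type*} [CommRing R] [IsLocalRing R]
    [Finite (ResidueField R)] [HenselianRing R (maximalIdeal R)] [CommRing B] [IsLocalRing B]
    [Algebra R B] [Algebra.IsIntegral R B]
    (hres : ∀ b : B, ∃ r : R, b - algebraMap R B r ∈ maximalIdeal B) {e : ℕ} (he0 : e ≠ 0)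
    (he : e.Coprime (Nat.card (ResidueField R))) {u : R} (hu : IsUnit u) {b : B}
    (hb : b ^ e.gcd (Nat.card (ResidueField R) - 1) = algebraMap R B u) : ∃ c : R, c ^ e = u := by
  set q := Nat.card (ResidueField R)
  have hd0 : e.gcd (q - 1) ≠ 0 := fun h => he0 (Nat.eq_zero_of_gcd_eq_zero_left h)
  have hbu : IsUnit b := (isUnit_pow_iff hd0).mp (hb ▸ hu.map _)
  obtain ⟨r, hr⟩ := hres b
  obtain ⟨v, rfl⟩ := isUnit_of_sub_algebraMap_mem hbu hr
  obtain ⟨u, rfl⟩ := hu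
  have h1 : (u : R) - v ^ e.gcd (q - 1) ∈ maximalIdeal R := by
    rw [← algebraMap_mem_maximalIdeal_iff (B := B), map_sub, map_pow, ← hb]
    exact Ideal.mem_of_dvd _ (sub_dvd_pow_sub_pow _ _ _) hr
  -- By Bézout, `v ^ gcd(e, q - 1)` is `a ^ e` times a power of `v ^ (q - 1)`, which is a one-unit.
  -- So `u a⁻ᵉ` is a one-unit, and Hensel's lemma applies.
  set a := (v ^ e.gcdA (q - 1) : Rˣ)
  have h2 : residue R u = residue R (a ^ e : Rˣ) := by
    have h3 : residue R u = residue R (v ^ e.gcd (q - 1) : Rˣ) := by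
      rw [← sub_eq_zero, ← map_sub, residue_eq_zero_iff, Units.val_pow_eq_pow_val]
      exact h1
    have h4 : (Units.map (residue R).toMonoidHom v) ^ (q - 1) = 1 := by
      have := pow_card_sub_one_sub_one_mem v.isUnit
      rw [← residue_eq_zero_iff, map_sub, map_pow, map_one, sub_eq_zero] at this
      exact Units.ext (by simpa using this)
    have h5 : Units.map (residue R).toMonoidHom (v ^ e.gcd (q - 1)) =
        Units.map (residue R).toMonoidHom (a ^ e) := by
      have h6 : v ^ e.gcd (q - 1) = a ^ e * (v ^ (q - 1)) ^ e.gcdB (q - 1) := by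
        simp only [a, ← zpow_natCast, ← zpow_mul]
        rw [← zpow_add, Nat.gcd_eq_gcd_ab, mul_comm (e : ℤ)]
      rw [h6, map_mul, map_zpow _ (v ^ (q - 1)), map_pow _ v, h4, one_zpow, mul_one]
    rw [h3]
    exact congrArg Units.val h5
  obtain ⟨w, hw, -⟩ := HenselianRing.exists_pow_eq (maximalIdeal R) he0
    (isUnit_natCast_of_coprime he) (x := (u * (a ^ e)⁻¹ : Rˣ)) (by
      rw [← residue_eq_zero_iff, map_sub, map_one, Units.val_mul, map_mul, h2, ← map_mul,
        Units.mul_inv, map_one, sub_self])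
  exact ⟨w * a, by
    rw [mul_pow, hw, ← Units.val_pow_eq_pow_val, ← Units.val_mul, inv_mul_cancel_right]⟩

variable (R) in
/-- A Henselian local domain with finite residue field contains the `(q - 1)`-th roots of unity. -/
theorem IsLocalRing.exists_isPrimitiveRoot_card_sub_one [HenselianRing R (maximalIdeal R)] :
    ∃ ζ : R, IsPrimitiveRoot ζ (Nat.card (ResidueField R) - 1) := by
  set q := Nat.card (ResidueField R)
  have hq1 : 1 < q := Finite.one_lt_card
  obtain ⟨g, hg⟩ := IsCyclic.exists_generator (α := (ResidueField R)ˣ)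
  have hgo : orderOf g = q - 1 := by
    rw [orderOf_eq_card_of_forall_mem_zpowers hg, Nat.card_units]
  obtain ⟨a, ha⟩ := residue_surjective (g : ResidueField R)
  have hau : IsUnit a := (residue_ne_zero_iff_isUnit a).mp (ha ▸ g.ne_zero)
  have hcop : (q - 1).Coprime q := by
    obtain ⟨m, hm⟩ : ∃ m, q = m + 1 := ⟨q - 1, by omega⟩
    simp [hm]
  -- Dividing `a` by this `(q - 1)`-th root of `a ^ (q - 1)` gives the Teichmüller lift of the
  -- generator `g`.
  obtain ⟨w, hw, hw1⟩ := HenselianRing.exists_pow_eq (maximalIdeal R) (by omega)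
    (isUnit_natCast_of_coprime hcop) (pow_card_sub_one_sub_one_mem hau)
  have hwu : IsUnit w := (isUnit_pow_iff (by omega)).mp (hw ▸ hau.pow (q - 1))
  obtain ⟨w, rfl⟩ := hwu
  have hres : residue R (a * ↑w⁻¹) = g := by
    rw [← residue_eq_zero_iff, map_sub, map_one, sub_eq_zero] at hw1
    have h1 : residue R w * residue R ↑w⁻¹ = 1 := by rw [← map_mul, w.mul_inv, map_one]
    rw [hw1, one_mul] at h1
    rw [map_mul, h1, mul_one, ha]
  refine ⟨a * ↑w⁻¹, ⟨?_, fun l hl => ?_⟩⟩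
  · rw [mul_pow, ← hw, ← mul_pow, w.mul_inv, one_pow]
  · rw [← hgo]
    refine orderOf_dvd_of_pow_eq_one (Units.ext ?_)
    rw [Units.val_pow_eq_pow_val, ← hres, ← map_pow, hl, map_one, Units.val_one]

end

/-! ### Transfer to the field extension -/

section

variable {R K L : Type*} [CommRing R] [IsDomain R] [IsDiscreteValuationRing R]
  [IsAdicComplete (maximalIdeal R) R]
    [Finite (IsLocalRing.ResidueField R)]
  [Field K] [Algebra R K] [IsFractionRing R K] [Field L] [Algebra K L] [Algebra R L]
  [IsScalarTower R K L] [FiniteDimensional K L]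

/-- The trace of an inseparable extension vanishes, whereas the trace of `1` is the degree, a unit
of `R`. -/
theorem Algebra.IsSeparable.of_finrank_coprime {R : Type*} (K L : Type*) [CommRing R]
    [IsLocalRing R] [Finite (IsLocalRing.ResidueField R)] [Field K] [Algebra R K] [Field L]
    [Algebra K L]
    (hc : (Module.finrank K L).Coprime (Nat.card (IsLocalRing.ResidueField R))) :
    Algebra.IsSeparable K L := by
  by_contra h
  have h1 := Algebra.trace_algebraMap (S := L) (1 : K)
  rw [Algebra.trace_eq_zero_of_not_isSeparable h, LinearMap.zero_apply, nsmul_one] at h1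
  have h2 := (isUnit_natCast_of_coprime hc).map (algebraMap R K)
  rw [map_natCast, ← h1] at h2
  exact not_isUnit_zero h2

/-- The valuation ring of a totally tamely ramified extension. -/
theorem integralClosure.exists_residual_of_ramificationIdxIn_eq
    (h : (maximalIdeal R).ramificationIdxIn (integralClosure R L) = Module.finrank K L)
    (hc : (Module.finrank K L).Coprime (Nat.card (ResidueField R))) :
    ∃ _ : IsLocalRing (integralClosure R L),
      (∀ b : integralClosure R L, ∃ r : R,
        b - algebraMap R (integralClosure R L) r ∈ maximalIdeal (integralClosure R L)) ∧
      ∃ (π : R) (α : integralClosure R L), Irreducible π ∧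
        α ^ Module.finrank K L = algebraMap R (integralClosure R L) π := by
  have := Algebra.IsSeparable.of_finrank_coprime K L hc
  have : FaithfulSMul R K := inferInstance
  have : FaithfulSMul R L := FaithfulSMul.trans R K L
  have : IsDedekindDomain (integralClosure R L) := integralClosure.isDedekindDomain R K L
  have : Module.Finite R (integralClosure R L) := IsIntegralClosure.finite R K L _
  have : IsFractionRing (integralClosure R L) L :=
    integralClosure.isFractionRing_of_finite_extension K L
  have hloc := Algebra.IsIntegral.isLocalRing_of_isAdicComplete R (integralClosure R L)
  have : IsDiscreteValuationRing (integralClosure R L) :=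
    IsDedekindDomain.isDiscreteValuationRing_of_isIntegral R
  have hrank : Module.finrank K L = Module.finrank R (integralClosure R L) :=
    IsFractionRing.finrank_eq R K (integralClosure R L) L
  rw [Ideal.ramificationIdxIn_maximalIdeal] at h
  rw [hrank] at h hc ⊢
  exact ⟨hloc, Ideal.algebraMap_quotient_surjective_of_ramificationIdx_eq h,
    exists_pow_eq_irreducible_of_ramificationIdx_eq h hc⟩

theorem exists_pow_finrank_eq_irreducible
    (h : (maximalIdeal R).ramificationIdxIn (integralClosure R L) = Module.finrank K L)
    (hc : (Module.finrank K L).Coprime (Nat.card (ResidueField R))) :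
    ∃ (π : R) (α : L), Irreducible π ∧ α ^ Module.finrank K L = algebraMap R L π := by
  obtain ⟨_, -, π, α, hπ, hα⟩ := integralClosure.exists_residual_of_ramificationIdxIn_eq h hc
  refine ⟨π, α, hπ, ?_⟩
  simpa using congrArg (algebraMap (integralClosure R L) L) hα

theorem pow_card_residueField_sub_one_eq_one
    (h : (maximalIdeal R).ramificationIdxIn (integralClosure R L) = Module.finrank K L)
    (hc : (Module.finrank K L).Coprime (Nat.card (ResidueField R)))
    {n : ℕ} (hn0 : n ≠ 0) (hn : n.Coprime (Nat.card (ResidueField R))) {z : L} (hz : z ^ n = 1) :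
    z ^ (Nat.card (ResidueField R) - 1) = 1 := by
  have : FaithfulSMul R L := FaithfulSMul.trans R K L
  obtain ⟨_, hres, -⟩ := integralClosure.exists_residual_of_ramificationIdxIn_eq h hc
  have hint : IsIntegral R z := IsIntegral.of_pow (Nat.pos_of_ne_zero hn0) (hz ▸ isIntegral_one)
  have h1 := pow_card_sub_one_eq_one_of_pow_eq_one hres hn0 hn
    (z := ⟨z, hint⟩) (Subtype.ext (by simpa using hz))
  simpa using congrArg Subtype.val h1

theorem exists_pow_finrank_eq_of_pow_gcd_eq
    (h : (maximalIdeal R).ramificationIdxIn (integralClosure R L) = Module.finrank K L)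
    (hc : (Module.finrank K L).Coprime (Nat.card (ResidueField R))) {u : R} (hu : IsUnit u) {b : L}
    (hb : b ^ (Module.finrank K L).gcd (Nat.card (ResidueField R) - 1) = algebraMap R L u) :
    ∃ c : R, c ^ Module.finrank K L = u := by
  have : FaithfulSMul R L := FaithfulSMul.trans R K L
  obtain ⟨_, hres, -⟩ := integralClosure.exists_residual_of_ramificationIdxIn_eq h hc
  have he0 : Module.finrank K L ≠ 0 := Module.finrank_pos.ne'
  have hint : IsIntegral R b :=
    IsIntegral.of_pow (Nat.gcd_pos_of_pos_left _ (Nat.pos_of_ne_zero he0))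
      (hb ▸ isIntegral_algebraMap)
  exact exists_eq_pow_of_pow_gcd_eq hres he0 hc hu (b := ⟨b, hint⟩)
    (Subtype.ext (by simpa using hb))

end

/-! ### Radical extensions generated by roots of a uniformizer -/

section

open IntermediateField

variable {R K Ω : Type*} [CommRing R] [IsDomain R] [IsDiscreteValuationRing R]
  [Field K] [Algebra R K] [IsFractionRing R K] [Field Ω] [Algebra K Ω] [Algebra R Ω]
  [IsScalarTower R K Ω]

theorem minpoly_eq_X_pow_sub_C_of_irreducible {n : ℕ} (hn : n ≠ 0) {π : R} (hπ : Irreducible π)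
    {x : Ω} (hx : x ^ n = algebraMap R Ω π) :
    minpoly K x = Polynomial.X ^ n - Polynomial.C (algebraMap R K π) :=
  (minpoly.eq_of_irreducible_of_monic
    (Polynomial.irreducible_X_pow_sub_C_of_irreducible K hn hπ)
    (by simp [hx, ← IsScalarTower.algebraMap_apply]) (Polynomial.monic_X_pow_sub_C _ hn)).symm

theorem isIntegral_of_pow_eq_algebraMap {R K Ω : Type*} [CommRing R] [Field K] [Algebra R K]
    [Field Ω] [Algebra K Ω] [Algebra R Ω] [IsScalarTower R K Ω] {n : ℕ} (hn : n ≠ 0) {π : R} {x : Ω}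
    (hx : x ^ n = algebraMap R Ω π) : IsIntegral K x :=
  IsIntegral.of_pow (Nat.pos_of_ne_zero hn) (by
    rw [hx, IsScalarTower.algebraMap_apply R K Ω]; exact isIntegral_algebraMap)

theorem finrank_adjoin_of_pow_eq_irreducible {n : ℕ} (hn : n ≠ 0) {π : R} (hπ : Irreducible π)
    {x : Ω} (hx : x ^ n = algebraMap R Ω π) : Module.finrank K K⟮x⟯ = n := by
  rw [adjoin.finrank (isIntegral_of_pow_eq_algebraMap hn hx),
    minpoly_eq_X_pow_sub_C_of_irreducible hn hπ hx, Polynomial.natDegree_X_pow_sub_C]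

theorem adjoin_eq_of_pow_finrank_eq_irreducible {L : IntermediateField K Ω}
    [FiniteDimensional K L] {n : ℕ} (hn : Module.finrank K L = n) {π : R} (hπ : Irreducible π)
    {x : Ω} (hxL : x ∈ L) (hx : x ^ n = algebraMap R Ω π) : K⟮x⟯ = L :=
  eq_of_le_of_finrank_eq (adjoin_simple_le_iff.mpr hxL) (by
    rw [hn, finrank_adjoin_of_pow_eq_irreducible (hn ▸ Module.finrank_pos.ne') hπ hx])

/-- A Kummer extension generated by a root of a uniformizer is cyclic. -/
theorem isGalois_isCyclic_adjoin_of_pow_eq_irreducible {n : ℕ} (hn : n ≠ 0) {ζ : K}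
    (hζ : IsPrimitiveRoot ζ n) {π : R} (hπ : Irreducible π) {x : Ω}
    (hx : x ^ n = algebraMap R Ω π) : IsGalois K K⟮x⟯ ∧ IsCyclic Gal(K⟮x⟯/K) := by
  have hrank := finrank_adjoin_of_pow_eq_irreducible (K := K) hn hπ hx
  have := adjoin.finiteDimensional (isIntegral_of_pow_eq_algebraMap (K := K) hn hx)
  have hroots : (primitiveRoots (Module.finrank K K⟮x⟯) K).Nonempty := by
    rw [hrank]
    exact ⟨ζ, (mem_primitiveRoots (Nat.pos_of_ne_zero hn)).mpr hζ⟩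
  have htfae := (isCyclic_tfae K K⟮x⟯ hroots).out 2 0
  refine htfae.mp ⟨AdjoinSimple.gen K x, ⟨algebraMap R K π, ?_⟩, ?_⟩
  · rw [hrank]
    exact Subtype.ext ((IsScalarTower.algebraMap_apply R K Ω π).symm.trans hx.symm)
  · exact lift_injective _ (by rw [lift_adjoin_simple, AdjoinSimple.coe_gen, lift_top])

/-- Conjugate elements: two roots of `X ^ n - π` are related by an automorphism. -/
theorem exists_algEquiv_of_pow_eq_irreducible [Normal K Ω] {n : ℕ} (hn : n ≠ 0) {π : R}
    (hπ : Irreducible π) {x y : Ω} (hx : x ^ n = algebraMap R Ω π)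
    (hy : y ^ n = algebraMap R Ω π) : ∃ σ : Gal(Ω/K), σ x = y := by
  have h : IsConjRoot K y x := by
    rw [IsConjRoot, minpoly_eq_X_pow_sub_C_of_irreducible hn hπ hx,
      minpoly_eq_X_pow_sub_C_of_irreducible hn hπ hy]
  exact isConjRoot_iff_exists_algEquiv.mp h

end

/-! ### The maximal Galois subextension -/

section

open IntermediateField Module

variable {R K Ω : Type*} [CommRing R] [IsDomain R] [IsDiscreteValuationRing R]
  [IsAdicComplete (maximalIdeal R) R]
    [Finite (IsLocalRing.ResidueField R)]
  [Field K] [Algebra R K] [IsFractionRing R K] [Field Ω] [Algebra K Ω] [Algebra R Ω]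
  [IsScalarTower R K Ω]

theorem exists_isPrimitiveRoot_card_residueField_sub_one (R K : Type*) [CommRing R] [IsDomain R]
    [IsLocalRing R] [IsAdicComplete (maximalIdeal R) R]
    [Finite (IsLocalRing.ResidueField R)]
    [Field K] [Algebra R K] [IsFractionRing R K] :
    ∃ ζ : K, IsPrimitiveRoot ζ (Nat.card (IsLocalRing.ResidueField R) - 1) := by
  obtain ⟨ζ, hζ⟩ := exists_isPrimitiveRoot_card_sub_one R
  exact ⟨_, hζ.map_of_injective (IsFractionRing.injective R K)⟩

theorem natCast_ne_zero_of_coprime_card_residueField {R Ω : Type*} [CommRing R] [IsLocalRing R]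
    [Finite (IsLocalRing.ResidueField R)] [Field Ω] [Algebra R Ω] {n : ℕ}
    (hn : n.Coprime (Nat.card (IsLocalRing.ResidueField R))) : (n : Ω) ≠ 0 := by
  simpa using ((isUnit_natCast_of_coprime hn).map (algebraMap R Ω)).ne_zero

theorem exists_isPrimitiveRoot_of_natCast_ne_zero (Ω : Type*) [Field Ω] [IsAlgClosed Ω] {n : ℕ}
    (hn : (n : Ω) ≠ 0) : ∃ ξ : Ω, IsPrimitiveRoot ξ n := by
  have : NeZero (n : Ω) := ⟨hn⟩
  have : NeZero n := NeZero.of_neZero_natCast Ω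
  obtain ⟨ξ, hξ⟩ := IsAlgClosed.exists_root (Polynomial.cyclotomic n Ω)
    (Polynomial.degree_cyclotomic_pos n Ω (NeZero.pos n)).ne'
  exact ⟨ξ, Polynomial.isRoot_cyclotomic_iff.mp hξ⟩

/-- If `α ^ e` is a uniformizer of the base and `α` generates a totally tame extension `L`
of degree `e`, then a subfield of degree `f` contains the element `α ^ (e / f)`. -/
theorem pow_finrank_mem_of_le {L M : IntermediateField K Ω} [FiniteDimensional K L] (hML : M ≤ L)
    (hroot : ∀ z ∈ L, z ^ finrank K L = 1 → z ^ (Nat.card (ResidueField R) - 1) = 1)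
    {π : R} (hπ : Irreducible π) {α : Ω} (hαL : α ∈ L)
    (hα : α ^ finrank K L = algebraMap R Ω π) :
    ∃ k, finrank K M * k = finrank K L ∧ α ^ k ∈ M := by
  let : Algebra M L := (inclusion hML).toRingHom.toAlgebra
  have : IsScalarTower K M L := IsScalarTower.of_algebraMap_eq fun _ => rfl
  have : IsScalarTower M L Ω := IsScalarTower.of_algebraMap_eq fun _ => rfl
  refine ⟨finrank M L, finrank_mul_finrank K M L, ?_⟩
  set k := finrank M L
  let a : L := ⟨α, hαL⟩
  -- Both `γ` and `α ^ k` have `e`-th power `π ^ k`. Their quotient is a root of unity in `L`, hence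
  -- of order dividing `q - 1`, hence in `K`.
  let γ : M := Algebra.norm M a
  have hα0 : α ≠ 0 := by
    rintro rfl
    rw [zero_pow finrank_pos.ne', eq_comm, IsScalarTower.algebraMap_apply R K Ω, map_eq_zero,
      map_eq_zero_iff _ (IsFractionRing.injective R K)] at hα
    exact hπ.ne_zero hα
  have hγ : (γ : Ω) ^ finrank K L = (α ^ k) ^ finrank K L := by
    have h1 : a ^ finrank K L = algebraMap M L (algebraMap K M (algebraMap R K π)) :=
      Subtype.ext (hα.trans (IsScalarTower.algebraMap_apply R K Ω π))
    have h2 : γ ^ finrank K L = algebraMap K M (algebraMap R K π) ^ k := by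
      rw [← map_pow, h1, Algebra.norm_algebraMap]
    have h3 := congrArg (algebraMap M Ω) h2
    rw [map_pow, map_pow, ← IsScalarTower.algebraMap_apply, ← IsScalarTower.algebraMap_apply,
      ← hα] at h3
    rw [pow_right_comm]
    exact h3
  have hη : (γ / α ^ k : Ω) ^ (Nat.card (ResidueField R) - 1) = 1 := by
    refine hroot _ (div_mem (hML γ.2) (pow_mem hαL k)) ?_
    rw [div_pow, hγ, div_self (pow_ne_zero _ (pow_ne_zero _ hα0))]
  obtain ⟨ζ, hζ⟩ := exists_isPrimitiveRoot_card_residueField_sub_one R K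
  have hq : Nat.card (ResidueField R) - 1 ≠ 0 := by
    have : 1 < Nat.card (ResidueField R) := Finite.one_lt_card
    omega
  have : NeZero (Nat.card (ResidueField R) - 1) := ⟨hq⟩
  obtain ⟨i, -, hi⟩ := (hζ.map_of_injective (algebraMap K Ω).injective).eq_pow_of_pow_eq_one hη
  have hηM : (γ / α ^ k : Ω) ∈ M := by
    rw [← hi, ← map_pow]
    exact M.algebraMap_mem _
  have : α ^ k = γ / (γ / α ^ k) := by
    have hγ0 : (γ : Ω) ≠ 0 := by
      intro h0
      rw [h0, zero_pow finrank_pos.ne'] at hγ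
      exact pow_ne_zero _ (pow_ne_zero _ hα0) hγ.symm
    field_simp
  rw [this]
  exact div_mem γ.2 hηM

/-- The element `α ^ k` of `M` is an `f`-th root of `π`. Its conjugate `ξ α ^ k`, with `ξ` a
primitive `f`-th root of unity, lies in `M` by normality, so `ξ ∈ L` and its order divides `q - 1`.
-/
theorem finrank_dvd_card_sub_one_of_normal [IsAlgClosed Ω] [Normal K Ω]
    {L M : IntermediateField K Ω} [FiniteDimensional K L] (hML : M ≤ L) [Normal K M]
    (hc : (finrank K L).Coprime (Nat.card (ResidueField R)))
    (hroot : ∀ n ≠ 0, n.Coprime (Nat.card (ResidueField R)) → ∀ z ∈ L, z ^ n = 1 →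
      z ^ (Nat.card (ResidueField R) - 1) = 1)
    {π : R} (hπ : Irreducible π) {α : Ω} (hαL : α ∈ L)
    (hα : α ^ finrank K L = algebraMap R Ω π) :
    finrank K M ∣ Nat.card (ResidueField R) - 1 := by
  obtain ⟨k, hk, hkM⟩ := pow_finrank_mem_of_le hML (hroot _ finrank_pos.ne' hc) hπ hαL hα
  set f := finrank K M
  have hf0 : f ≠ 0 := by
    rintro h0
    rw [h0, zero_mul] at hk
    exact finrank_pos.ne hk
  have hδ : (α ^ k) ^ f = algebraMap R Ω π := by rw [← pow_mul, mul_comm, hk, hα]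
  have hfc : f.Coprime (Nat.card (ResidueField R)) := hc.coprime_dvd_left ⟨k, hk.symm⟩
  obtain ⟨ξ, hξ⟩ := exists_isPrimitiveRoot_of_natCast_ne_zero Ω
    (natCast_ne_zero_of_coprime_card_residueField (R := R) hfc)
  obtain ⟨σ, hσ⟩ := exists_algEquiv_of_pow_eq_irreducible (K := K) hf0 hπ hδ (y := ξ * α ^ k)
    (by rw [mul_pow, hξ.pow_eq_one, one_mul, hδ])
  have hmem : ξ * α ^ k ∈ M := by
    rw [← hσ]
    exact (normal_iff_forall_map_le'.mp ‹Normal K M› σ) ⟨_, hkM, rfl⟩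
  have hδ0 : α ^ k ≠ 0 := by
    intro h0
    rw [h0, zero_pow hf0, eq_comm, IsScalarTower.algebraMap_apply R K Ω, map_eq_zero,
      map_eq_zero_iff _ (IsFractionRing.injective R K)] at hδ
    exact hπ.ne_zero hδ
  have hξM : ξ ∈ M := by
    rw [← mul_div_cancel_right₀ ξ hδ0]
    exact div_mem hmem hkM
  exact hξ.dvd_of_pow_eq_one _ (hroot f hf0 hfc ξ (hML hξM) hξ.pow_eq_one)

/-- The maximal Galois subextension of a totally tame extension generated by an `e`-th root `α`
of a uniformizer is generated by `α ^ (e / gcd(e, q - 1))`. -/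
theorem TameRamification.maxGalois_eq_adjoin [IsAlgClosed Ω] [Normal K Ω]
    {L : IntermediateField K Ω} [FiniteDimensional K L]
    (hc : (finrank K L).Coprime (Nat.card (ResidueField R)))
    (hroot : ∀ n ≠ 0, n.Coprime (Nat.card (ResidueField R)) → ∀ z ∈ L, z ^ n = 1 →
      z ^ (Nat.card (ResidueField R) - 1) = 1)
    {π : R} (hπ : Irreducible π) {α : Ω} (hαL : α ∈ L)
    (hα : α ^ finrank K L = algebraMap R Ω π) {k : ℕ}
    (hk : (finrank K L).gcd (Nat.card (ResidueField R) - 1) * k = finrank K L) :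
    TameRamification.maxGalois L = K⟮α ^ k⟯ ∧ IsCyclic Gal(K⟮α ^ k⟯/K) ∧
      finrank K K⟮α ^ k⟯ = (finrank K L).gcd (Nat.card (ResidueField R) - 1) := by
  set d := (finrank K L).gcd (Nat.card (ResidueField R) - 1)
  have hd0 : d ≠ 0 := (Nat.gcd_pos_of_pos_left _ finrank_pos).ne'
  have hδ : (α ^ k) ^ d = algebraMap R Ω π := by rw [← pow_mul, mul_comm, hk, hα]
  have hq : 0 < Nat.card (ResidueField R) - 1 := by
    have : 1 < Nat.card (ResidueField R) := Finite.one_lt_card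
    omega
  obtain ⟨ζ, hζ⟩ := exists_isPrimitiveRoot_card_residueField_sub_one R K
  obtain ⟨m, hm⟩ := Nat.gcd_dvd_right (finrank K L) (Nat.card (ResidueField R) - 1)
  obtain ⟨hgal, hcyc⟩ := isGalois_isCyclic_adjoin_of_pow_eq_irreducible hd0
    (hζ.pow hq (hm.trans (mul_comm _ _))) hπ hδ
  have hrank := finrank_adjoin_of_pow_eq_irreducible (K := K) hd0 hπ hδ
  refine ⟨?_, hcyc, hrank⟩
  obtain ⟨⟨hFL, hFgal⟩, hmax⟩ := isGreatest_maxGalois L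
  have hle : K⟮α ^ k⟯ ≤ maxGalois L :=
    hmax ⟨adjoin_simple_le_iff.mpr (pow_mem hαL k), hgal⟩
  have : FiniteDimensional K (maxGalois L) :=
    FiniteDimensional.of_injective (inclusion hFL).toLinearMap (inclusion_injective hFL)
  -- The degree divides both `e` and `q - 1`; comparison with the subfield of degree `d` then gives
  -- equality.
  have hdvd : finrank K (maxGalois L) ∣ d := by
    have := hFgal.to_normal
    refine Nat.dvd_gcd ?_ (finrank_dvd_card_sub_one_of_normal hFL hc hroot hπ hαL hα)
    exact finrank_dvd_of_le_right hFL
  exact (eq_of_le_of_finrank_le hle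
    (hrank ▸ Nat.le_of_dvd (Nat.pos_of_ne_zero hd0) hdvd)).symm

end

/-! ### Conjugacy of totally tame extensions -/

section

open IntermediateField Module

variable {R K Ω : Type*} [CommRing R] [IsDomain R] [IsDiscreteValuationRing R]
  [Field K] [Algebra R K] [IsFractionRing R K] [Field Ω] [Algebra K Ω] [Algebra R Ω]
  [IsScalarTower R K Ω]

/-- Two totally tame extensions of the same degree that share the `gcd(e, q - 1)`-th root of
a uniformizer are conjugate. -/
theorem exists_algEquiv_map_eq_of_pow_mem [Normal K Ω]
    {L L' : IntermediateField K Ω} [FiniteDimensional K L] [FiniteDimensional K L']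
    (hLL' : finrank K L' = finrank K L)
    (hpow : ∀ u : R, IsUnit u → ∀ b ∈ L',
      b ^ (finrank K L).gcd (Nat.card (ResidueField R) - 1) = algebraMap R Ω u →
      ∃ c : R, c ^ finrank K L = u)
    {π π' : R} (hπ : Irreducible π) (hπ' : Irreducible π') {α α' : Ω} (hαL : α ∈ L)
    (hα : α ^ finrank K L = algebraMap R Ω π) (hαL' : α' ∈ L')
    (hα' : α' ^ finrank K L = algebraMap R Ω π') {k : ℕ}
    (hk : (finrank K L).gcd (Nat.card (ResidueField R) - 1) * k = finrank K L)
    (hmem : α ^ k ∈ L') : ∃ σ : Gal(Ω/K), L' = L.map σ.toAlgHom := by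
  set d := (finrank K L).gcd (Nat.card (ResidueField R) - 1)
  have hinj : Function.Injective (algebraMap R Ω) := by
    rw [IsScalarTower.algebraMap_eq R K Ω]
    exact (algebraMap K Ω).injective.comp (IsFractionRing.injective R K)
  obtain ⟨u, hu⟩ := (IsDiscreteValuationRing.associated_of_irreducible R hπ hπ')
  have hπ0 : algebraMap R Ω π ≠ 0 := (map_ne_zero_iff _ hinj).mpr hπ.ne_zero
  -- The `d`-th power of `α' ^ k / α ^ k` is `π' / π = u`.
  obtain ⟨c, hc⟩ := hpow u u.isUnit (α' ^ k / α ^ k) (div_mem (pow_mem hαL' k) hmem) (by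
    rw [div_pow, ← pow_mul, ← pow_mul, mul_comm k, hk, hα, hα', ← hu, map_mul,
      mul_div_cancel_left₀ _ hπ0])
  have hu0 : algebraMap R Ω u ≠ 0 := (map_ne_zero_iff _ hinj).mpr u.ne_zero
  -- Since `c ^ e = u`, the element `α' / c` is another root of `X ^ e - π`.
  obtain ⟨σ, hσ⟩ := exists_algEquiv_of_pow_eq_irreducible (K := K) finrank_pos.ne' hπ hα
    (y := α' / algebraMap R Ω c) (by
      rw [div_pow, hα', ← map_pow, hc, ← hu, map_mul, mul_div_cancel_right₀ _ hu0])
  refine ⟨σ, ?_⟩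
  have hcL' : algebraMap R Ω c ∈ L' := by
    rw [IsScalarTower.algebraMap_apply R K Ω]
    exact L'.algebraMap_mem _
  rw [← adjoin_eq_of_pow_finrank_eq_irreducible rfl hπ hαL hα, adjoin_map, Set.image_singleton]
  refine (adjoin_eq_of_pow_finrank_eq_irreducible hLL' hπ ?_ ?_).symm
  · change σ α ∈ L'
    rw [hσ]
    exact div_mem hαL' hcL'
  · change σ α ^ _ = _
    rw [← map_pow, hα, IsScalarTower.algebraMap_apply R K Ω, AlgEquiv.commutes]

end

end LocalRing

/-! ### Local fields and the maximal tame extension -/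

namespace TameRamification

open IntermediateField Module

section

variable {K : Type*} [Field K] [ValuativeRel K] [TopologicalSpace K]
  [IsNonarchimedeanLocalField K]

variable (K) in
theorem isAdicComplete_maximalIdeal : IsAdicComplete 𝓂[K] 𝒪[K] :=
  letI := IsTopologicalAddGroup.rightUniformSpace K
  haveI := isUniformAddGroup_of_addCommGroup (G := K)
  inferInstance

variable {L M : Type*} [Field L] [Algebra K L] [Field M] [Algebra K M]

theorem ramificationIndex_congr (f : L ≃ₐ[K] M) :
    ramificationIndex K L = ramificationIndex K M := by
  have := isAdicComplete_maximalIdeal K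
  have : FaithfulSMul 𝒪[K] K := inferInstance
  have : FaithfulSMul 𝒪[K] L := FaithfulSMul.trans 𝒪[K] K L
  have : FaithfulSMul 𝒪[K] M := FaithfulSMul.trans 𝒪[K] K M
  exact Ideal.ramificationIdxIn_congr (AlgEquiv.mapIntegralClosure (f.restrictScalars 𝒪[K]))

theorem IsTamelyRamified.congr (f : L ≃ₐ[K] M) (hL : IsTamelyRamified K L) :
    IsTamelyRamified K M where
  finiteDimensional :=
    have := hL.finiteDimensional
    f.toLinearEquiv.finiteDimensional
  coprime := ramificationIndex_congr f ▸ hL.coprime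

end

variable {K : Type*} [Field K] [ValuativeRel K] [TopologicalSpace K]
  [IsNonarchimedeanLocalField K] {Ω : Type*} [Field Ω] [Algebra K Ω]

/-- Automorphisms of `Ω` permute the tamely ramified subextensions, because the ramification index
is an isomorphism invariant. -/
theorem normal_maxTame [Normal K Ω] : Normal K (maxTame K Ω) := by
  refine normal_iff_forall_map_le'.mpr fun σ => map_le_iff_le_comap.mpr (sSup_le fun M hM => ?_)
  exact map_le_iff_le_comap.mp (le_sSup (IsTamelyRamified.congr (M.equivMap σ.toAlgHom) hM))

/-- Conjugacy is found in `Ω`; normality of `E` lets the automorphism restrict to it. This is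
applied with `E` the maximal tame extension. -/
theorem exists_restrict_eq_map_of_eq_map {K Ω : Type*} [Field K] [Field Ω] [Algebra K Ω]
    [Normal K Ω] {L L' E : IntermediateField K Ω}
    [Normal K E] (hL : L ≤ E) (hL' : L' ≤ E) (σ : Gal(Ω/K)) (h : L' = L.map σ.toAlgHom) :
    ∃ g : Gal(E/K), restrict hL' = (restrict hL).map g.toAlgHom := by
  refine ⟨σ.restrictNormal E, lift_injective _ ?_⟩
  have h1 : σ.toAlgHom.comp E.val = E.val.comp (σ.restrictNormal E).toAlgHom :=
    AlgHom.ext fun x => (σ.restrictNormal_commutes E x).symm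
  have h2 : L.map σ.toAlgHom = ((restrict hL).map E.val).map σ.toAlgHom :=
    congrArg (map σ.toAlgHom) (lift_restrict hL).symm
  rw [lift_restrict, h, h2, lift, map_map, map_map, h1]

end TameRamification

theorem mainTheorem8 {K : Type*} [Field K] [ValuativeRel K] [TopologicalSpace K]
    [IsNonarchimedeanLocalField K]
    {Ω : Type*} [Field Ω] [Algebra K Ω] [IsAlgClosure K Ω]
    (e : ℕ) (L : IntermediateField K Ω)
    (hL : TameRamification.IsTotallyTamelyRamified K L) (he : Module.finrank K L = e)
    (F : IntermediateField K Ω) (hF : F = TameRamification.maxGalois L) :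
    IsCyclic Gal(F/K) ∧
    Module.finrank K F = Nat.gcd e (TameRamification.residueCard K - 1) ∧
    ∀ (L' : IntermediateField K Ω) (hL' : TameRamification.IsTotallyTamelyRamified K L'),
      Module.finrank K L' = e → F ≤ L' →
        ∃ g : Gal((TameRamification.maxTame K Ω)/K),
          IntermediateField.restrict hL'.le_maxTame =
            (IntermediateField.restrict hL.le_maxTame).map g.toAlgHom := by
  subst he
  have := TameRamification.isAdicComplete_maximalIdeal K
  have : IsAlgClosed Ω := IsAlgClosure.isAlgClosed K
  have : Normal K Ω := IsAlgClosure.normal K Ω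
  have := hL.finiteDimensional
  have hc : (Module.finrank K L).Coprime (Nat.card 𝓀[K]) :=
    hL.ramificationIndex_eq ▸ hL.coprime
  obtain ⟨π, α, hπ, hα⟩ :=
    exists_pow_finrank_eq_irreducible (R := 𝒪[K]) hL.ramificationIndex_eq hc
  replace hα := congrArg Subtype.val hα
  have hroot : ∀ n ≠ 0, n.Coprime (Nat.card 𝓀[K]) → ∀ z ∈ L, z ^ n = 1 →
      z ^ (Nat.card 𝓀[K] - 1) = 1 := by
    intro n hn0 hn z hz hzn
    exact congrArg Subtype.val (pow_card_residueField_sub_one_eq_one (R := 𝒪[K])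
      hL.ramificationIndex_eq hc hn0 hn (z := ⟨z, hz⟩) (Subtype.ext hzn))
  obtain ⟨k, hk⟩ := Nat.gcd_dvd_left (Module.finrank K L) (Nat.card 𝓀[K] - 1)
  obtain ⟨hmax, hcyc, hrank⟩ := TameRamification.maxGalois_eq_adjoin hc hroot hπ α.2 hα hk.symm
  rw [hmax] at hF
  subst hF
  refine ⟨hcyc, hrank, fun L' hL' hLL' hFL' => ?_⟩
  have := hL'.finiteDimensional
  have hc' : (Module.finrank K L').Coprime (Nat.card 𝓀[K]) := hLL' ▸ hc
  obtain ⟨π', α', hπ', hα'⟩ :=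
    exists_pow_finrank_eq_irreducible (R := 𝒪[K]) hL'.ramificationIndex_eq hc'
  replace hα' := congrArg Subtype.val hα'
  have hpow : ∀ u : 𝒪[K], IsUnit u → ∀ b ∈ L',
      b ^ (Module.finrank K L').gcd (Nat.card 𝓀[K] - 1) = algebraMap 𝒪[K] Ω u →
      ∃ c : 𝒪[K], c ^ Module.finrank K L' = u := fun u hu b hb hbu =>
    exists_pow_finrank_eq_of_pow_gcd_eq hL'.ramificationIndex_eq hc' hu (b := ⟨b, hb⟩)
      (Subtype.ext hbu)
  rw [hLL'] at hpow hα'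
  -- The inclusion of `F` in `L'` enters only through its generator `α ^ k`.
  obtain ⟨σ, hσ⟩ := exists_algEquiv_map_eq_of_pow_mem hLL' hpow hπ hπ' α.2 hα α'.2 hα' hk.symm
    (hFL' (IntermediateField.mem_adjoin_simple_self K _))
  have := TameRamification.normal_maxTame (K := K) (Ω := Ω)
  exact TameRamification.exists_restrict_eq_map_of_eq_map hL.le_maxTame hL'.le_maxTame σ hσ
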